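/- A \emph{path-matching} in a graph is a vertex-disjoint union of paths, each with at least two vertices; its \emph{order} is the number of vertices it spans. For an integer $r\ge 1$ and positive integers $p_1,\dots,p_r$, let $R^{PM}(p_1,\dots,p_r)$ be the smallest integer $n$ such that for every colouring of the edges of the complete graph $K_n$ with colours $1,\dots,r$ there is some $i\in\{1,\dots,r\}$ for which there exists a path-matching of order at least $p_i$ all of whose edges have colour $i$. Theorem. Let $r\ge 3$ and let $p_1\ge p_2\ge\dots\ge p_r\ge 2$ be integers with $p_1\ge 4$. If $$p_1\ \ge\ 2r-3-\sum_{i=2}^r 3\left(\left\lceil\frac{p_i}{3}\right\rceil-\frac{p_i}{3}\right),$$ then $$R^{PM}(p_1,\dots,p_r)=p_1-(r-1)+\sum_{i=2}^r\left\lceil\frac{p_i}{3}\right\rceil .$$ -/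

import Mathlib

namespace PathMatchingRamsey

/-- A path-matching in a graph `G`: a finite collection of pairwise vertex-disjoint paths of `G`,
each with at least two vertices. -/
structure PathMatching {V : Type*} (G : SimpleGraph V) where
  /-- The paths, each given with its two end vertices. -/
  paths : Finset (Σ u v : V, G.Path u v)
  /-- Every path has at least two vertices. -/
  two_le_vertices : ∀ P ∈ paths, 2 ≤ (P.2.2 : G.Walk P.1 P.2.1).support.length
  /-- Distinct paths have no common vertex. -/
  disjoint : ∀ P ∈ paths, ∀ Q ∈ paths, P ≠ Q →
    ∀ v : V, v ∈ (P.2.2 : G.Walk P.1 P.2.1).support →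
      v ∉ (Q.2.2 : G.Walk Q.1 Q.2.1).support

/-- The set of vertices spanned by a path-matching. -/
def PathMatching.verts {V : Type*} {G : SimpleGraph V} (M : PathMatching G) : Set V :=
  {v | ∃ P ∈ M.paths, v ∈ (P.2.2 : G.Walk P.1 P.2.1).support}

/-- The order of a path-matching: the number of vertices it spans. -/
noncomputable def PathMatching.order {V : Type*} {G : SimpleGraph V} (M : PathMatching G) : ℕ :=
  M.verts.ncard

/-- `Arrows p n`: every colouring of the edges of the complete graph on `n` vertices with colours
`Fin r` has, for some colour `i`, a path-matching of order at least `p i` all of whose edges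
have colour `i`. -/
def Arrows {r : ℕ} (p : Fin r → ℕ) (n : ℕ) : Prop :=
  ∀ c : SimpleGraph.TopEdgeLabeling (Fin n) (Fin r),
    ∃ i : Fin r, ∃ M : PathMatching (c.labelGraph i), p i ≤ M.order

/-- The Ramsey number of path-matchings: the smallest `n` with `Arrows p n`. -/
noncomputable def ramseyPM {r : ℕ} (p : Fin r → ℕ) : ℕ :=
  sInf {n : ℕ | Arrows p n}

end PathMatchingRamsey

/-! Put `q i = p i - 1`. Since `⌈p i / 3⌉ = q i / 3 + 1` with floor division, the claimed value is
`q i₀ + 1 + ∑ q i / 3` over `i ≠ i₀`, and the hypothesis on `p i₀` says that the residues `q i % 3`,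
`i ≠ i₀`, sum to at most `q i₀ + 2`.

Lower bound (`not_arrows`): split the vertices into a block of size `q i₀` and blocks of size `q i /
3`, and colour an edge by the larger block index. Colour `i₀` stays inside its block. Every edge of
another colour `i` meets block `i`, and a path has at most three vertices per vertex of such a
cover.

Upper bound (`arrows_of_card`): a maximum packing by stars with one or two leaves is a
path-matching, and alternating exchanges give a matching barrier (`exists_barrier`): sets `S i`, `A
i` with `#(A i) + 3 * #(S i) ≤ q i` such that each edge of colour `i` meets `S i` or lies in `A i`.
A colouring without the required path-matchings would thus cover the complete graph by few stars and
small cliques, which `not_covered_by_stars_and_cliques` excludes by double counting. -/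

open Finset

namespace PathMatchingRamsey

/-! ### Covering a complete graph by stars and cliques -/

section CliqueCover

variable {V : Type*} [DecidableEq V] {r : ℕ}

/-- The number of members of the family `B` that contain `v`. -/
def multiplicity (B : Fin r → Finset V) (v : V) : ℕ := #{i | v ∈ B i}

theorem sum_multiplicity (B : Fin r → Finset V) (W : Finset V) (hBW : ∀ i, B i ⊆ W) :
    ∑ v ∈ W, multiplicity B v = ∑ i, #(B i) := by
  simp only [multiplicity, card_filter]
  rw [sum_comm]
  refine sum_congr rfl fun i _ => ?_
  rw [← card_filter, filter_mem_eq_inter, inter_eq_right.2 (hBW i)]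

/-- A clique containing `v` misses some `x`, and the edge from `v` to `x` needs another clique. -/
theorem two_le_multiplicity {B : Fin r → Finset V} {W : Finset V}
    (hBW : ∀ i, B i ⊆ W) (hne : ∀ i, B i ≠ W) (hW : 2 ≤ #W)
    (hcov : ∀ u ∈ W, ∀ v ∈ W, u ≠ v → ∃ i, u ∈ B i ∧ v ∈ B i) {v : V} (hv : v ∈ W) :
    2 ≤ multiplicity B v := by
  obtain ⟨w, hw, hwv⟩ := exists_mem_ne (s := W) (by omega) v
  obtain ⟨i, hvi, -⟩ := hcov v hv w hw hwv.symm
  obtain ⟨x, hx, hxi⟩ : ∃ x ∈ W, x ∉ B i := by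
    by_contra! h
    exact hne i ((hBW i).antisymm h)
  obtain ⟨j, hvj, hxj⟩ := hcov v hv x hx (by rintro rfl; exact hxi hvi)
  have : ({i, j} : Finset (Fin r)) ⊆ ({i | v ∈ B i} : Finset (Fin r)) := by
    intro a ha
    simp only [mem_insert, mem_singleton] at ha
    rcases ha with rfl | rfl <;> simpa
  calc 2 = #({i, j} : Finset (Fin r)) := (card_pair (by rintro rfl; exact hxi hxj)).symm
    _ ≤ _ := card_le_card this

theorem subset_union_of_multiplicity_eq_two {B : Fin r → Finset V} {W : Finset V}
    (hcov : ∀ u ∈ W, ∀ v ∈ W, u ≠ v → ∃ i, u ∈ B i ∧ v ∈ B i) {v : V} (hv : v ∈ W)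
    (h2 : multiplicity B v = 2) {i j : Fin r} (hij : i ≠ j) (hi : v ∈ B i) (hj : v ∈ B j) :
    W ⊆ B i ∪ B j := by
  have hs : ({i, j} : Finset (Fin r)) = ({i | v ∈ B i} : Finset (Fin r)) := by
    refine eq_of_subset_of_card_le ?_ ?_
    · intro a ha
      simp only [mem_insert, mem_singleton] at ha
      rcases ha with rfl | rfl <;> simpa
    · rw [card_pair hij]; exact h2.le
  intro w hw
  by_cases hvw : v = w
  · subst hvw; simp [hi]
  obtain ⟨l, hvl, hwl⟩ := hcov v hv w hw hvw
  have : l ∈ ({i, j} : Finset (Fin r)) := by rw [hs]; simpa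
  simp only [mem_insert, mem_singleton] at this
  rcases this with rfl | rfl <;> simp [hwl]

theorem exists_ne_of_multiplicity_eq_two {B : Fin r → Finset V} {v : V}
    (h2 : multiplicity B v = 2) (i : Fin r) : ∃ j, j ≠ i ∧ v ∈ B j := by
  obtain ⟨j, hj, hji⟩ := exists_mem_ne (s := ({i | v ∈ B i} : Finset (Fin r)))
    (by change 1 < multiplicity B v; omega) i
  exact ⟨j, hji, by simpa using hj⟩

/-- If more vertices than the size of any clique lie in exactly two cliques of a clique covering,
then some three of the cliques cover every vertex twice. -/
theorem exists_three_cliques {B : Fin r → Finset V} {W : Finset V} (hBW : ∀ i, B i ⊆ W)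
    (hcov : ∀ u ∈ W, ∀ v ∈ W, u ≠ v → ∃ i, u ∈ B i ∧ v ∈ B i)
    (hlarge : ∀ i, #(B i) < #{v ∈ W | multiplicity B v = 2}) (h0 : 0 < r) :
    ∃ i j l, i ≠ j ∧ i ≠ l ∧ j ≠ l ∧ 2 * #W ≤ #(B i) + #(B j) + #(B l) := by
  have hout : ∀ i, ∃ v ∈ W, multiplicity B v = 2 ∧ v ∉ B i := by
    intro i
    obtain ⟨v, hv, hvi⟩ := exists_mem_notMem_of_card_lt_card (hlarge i)
    rw [mem_filter] at hv
    exact ⟨v, hv.1, hv.2, hvi⟩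
  obtain ⟨v, hv, hv2, -⟩ := hout ⟨0, h0⟩
  obtain ⟨i, hi⟩ : ∃ i, v ∈ B i := by
    have : ({i | v ∈ B i} : Finset (Fin r)).Nonempty := by
      rw [← card_pos]; change 0 < multiplicity B v; omega
    obtain ⟨i, hi⟩ := this
    exact ⟨i, by simpa using hi⟩
  obtain ⟨j, hji, hj⟩ := exists_ne_of_multiplicity_eq_two hv2 i
  have hWij := subset_union_of_multiplicity_eq_two hcov hv hv2 hji.symm hi hj
  obtain ⟨w, hw, hw2, hwi⟩ := hout i
  have hwj : w ∈ B j := by simpa [hwi] using hWij hw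
  obtain ⟨l, hlj, hl⟩ := exists_ne_of_multiplicity_eq_two hw2 j
  have hli : l ≠ i := by rintro rfl; exact hwi hl
  have hWjl := subset_union_of_multiplicity_eq_two hcov hw hw2 hlj.symm hwj hl
  obtain ⟨u, hu, hu2, huj⟩ := hout j
  have hui : u ∈ B i := by simpa [huj] using hWij hu
  have hul : u ∈ B l := by simpa [huj] using hWjl hu
  have hWil := subset_union_of_multiplicity_eq_two hcov hu hu2 hli.symm hui hul
  refine ⟨i, j, l, hji.symm, hli.symm, hlj.symm, ?_⟩
  have key : ∀ x ∈ W, 2 ≤ (if x ∈ B i then 1 else 0) + (if x ∈ B j then 1 else 0)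
      + (if x ∈ B l then 1 else 0) := by
    intro x hx
    have h1 := hWij hx
    have h2 := hWjl hx
    have h3 := hWil hx
    simp only [mem_union] at h1 h2 h3
    split_ifs <;> simp_all
  have := sum_le_sum key
  simp only [sum_const, smul_eq_mul, sum_add_distrib, ← card_filter, filter_mem_eq_inter,
    inter_eq_right.2 (hBW _)] at this
  omega

/-- Arithmetic for three cliques all different from that of `i₀`. The size bounds alone force `Q ≤
6`; the bound on the residues is needed to exclude `Q = 3`, `s = 1` with all residues 2. -/
theorem three_residues_lt {Q k₁ k₂ k₃ f₁ f₂ f₃ s : ℕ} (hQ : 3 ≤ Q) (h₁ : 3 * k₁ + f₁ ≤ Q)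
    (h₂ : 3 * k₂ + f₂ ≤ Q) (h₃ : 3 * k₃ + f₃ ≤ Q) (hf₁ : f₁ < 3) (hf₂ : f₂ < 3) (hf₃ : f₃ < 3)
    (hs : 3 * s ≤ Q) (hf : f₁ + (f₂ + f₃) ≤ Q + 2) :
    ¬ 2 * Q + 2 ≤ 2 * s + (k₁ + f₁) + (k₂ + f₂) + (k₃ + f₃) := by
  intro h
  have hQ6 : Q ≤ 6 := by omega
  interval_cases Q <;> interval_cases f₁ <;> omega

/-- A complete graph on `q 0 + 1 + ∑ i ≠ 0, q i / 3` vertices is not covered by stars centred in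
`S i` and cliques `A i` with `#(A i) + 3 * #(S i) ≤ q i`. -/
theorem not_covered_by_stars_and_cliques [Fintype V] (i₀ : Fin r) (q : Fin r → ℕ)
    (hq : ∀ i, q i ≤ q i₀)
    (hq0 : 3 ≤ q i₀) (hmod : ∑ i ∈ univ.erase i₀, q i % 3 ≤ q i₀ + 2)
    (hV : Fintype.card V = q i₀ + 1 + ∑ i ∈ univ.erase i₀, q i / 3)
    (S A : Fin r → Finset V) (hSA : ∀ i, #(A i) + 3 * #(S i) ≤ q i)
    (hcov : ∀ u v, u ≠ v → ∃ i, u ∈ S i ∨ v ∈ S i ∨ (u ∈ A i ∧ v ∈ A i)) : False := by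
  set W : Finset V := univ \ univ.biUnion S with hWdef
  set B : Fin r → Finset V := fun i => A i ∩ W with hB
  have hBW : ∀ i, B i ⊆ W := fun i => inter_subset_right
  have hBA : ∀ i, #(B i) + 3 * #(S i) ≤ q i := fun i =>
    (Nat.add_le_add_right (card_le_card inter_subset_left) _).trans (hSA i)
  have hcovB : ∀ u ∈ W, ∀ v ∈ W, u ≠ v → ∃ i, u ∈ B i ∧ v ∈ B i := by
    intro u hu v hv huv
    have hu' := hu
    have hv' := hv
    simp only [hWdef, mem_sdiff, mem_univ, mem_biUnion, true_and, not_exists] at hu' hv'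
    obtain ⟨i, h | h | h⟩ := hcov u v huv
    · exact absurd h (hu' i)
    · exact absurd h (hv' i)
    · exact ⟨i, mem_inter.2 ⟨h.1, hu⟩, mem_inter.2 ⟨h.2, hv⟩⟩
  -- `x i` is what remains of the budget `q i / 3` once the star centres are paid for.
  obtain ⟨x, hx⟩ : ∃ x : Fin r → ℕ, ∀ i, x i + #(S i) = q i / 3 :=
    ⟨fun i => q i / 3 - #(S i), fun i => by have := hBA i; grind⟩
  set K := ∑ i ∈ univ.erase i₀, x i with hK
  have hWcard : q i₀ + 1 + K ≤ #W + #(S i₀) := by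
    have h1 : #(univ.biUnion S) ≤ ∑ i, #(S i) := card_biUnion_le
    have h2 : #W + #(univ.biUnion S) = Fintype.card V := by
      rw [hWdef, card_sdiff_add_card_eq_card (subset_univ _), card_univ]
    rw [← add_sum_erase _ _ (mem_univ i₀)] at h1
    have h3 : K + ∑ i ∈ univ.erase i₀, #(S i) = ∑ i ∈ univ.erase i₀, q i / 3 := by
      rw [hK, ← sum_add_distrib]; exact sum_congr rfl fun i _ => hx i
    omega
  have hsum : ∑ i, #(B i) + 3 * #(S i₀) ≤ 2 * q i₀ + 2 + 3 * K := by
    rw [← add_sum_erase _ _ (mem_univ i₀)]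
    have h1 : ∑ i ∈ univ.erase i₀, #(B i) ≤ ∑ i ∈ univ.erase i₀, (3 * x i + q i % 3) :=
      sum_le_sum fun i _ => by have := hBA i; have := hx i; omega
    rw [sum_add_distrib, ← mul_sum] at h1
    have := hBA i₀
    omega
  have hS0 := hBA i₀
  have hK1 : ∀ i, i ≠ i₀ → x i ≤ K := fun i hi =>
    single_le_sum (f := x) (fun _ _ => Nat.zero_le _) (mem_erase.2 ⟨hi, mem_univ i⟩)
  have hne : ∀ i, B i ≠ W := by
    intro i hi
    have h1 := hBA i
    rw [hi] at h1
    by_cases h : i = i₀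
    · subst h; omega
    have := hK1 i h
    have := hx i
    have := hx i₀
    have := hq i
    omega
  have hdeg : ∀ v ∈ W, 2 ≤ multiplicity B v := fun v hv =>
    two_le_multiplicity hBW hne (by have := hx i₀; omega) hcovB hv
  -- All multiplicities are at least 2, so at least `3 * #W - ∑ #(B i)` vertices have multiplicity
  -- exactly 2; the terms in `K` and `#(S i₀)` cancel in this bound.
  have hmany : q i₀ + 1 ≤ #{v ∈ W | multiplicity B v = 2} := by
    have h1 : ∑ v ∈ W, 3 ≤ ∑ v ∈ W, (multiplicity B v + if multiplicity B v = 2 then 1 else 0) :=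
      sum_le_sum fun v hv => by have := hdeg v hv; split_ifs <;> omega
    rw [sum_add_distrib, ← card_filter, sum_multiplicity B W hBW] at h1
    simp only [sum_const, smul_eq_mul] at h1
    omega
  obtain ⟨i, j, l, hij, hil, hjl, h2⟩ := exists_three_cliques hBW hcovB
    (fun i => by have := hBA i; have := hq i; omega) i₀.pos
  have final : ∀ i j l : Fin r, i ≠ j → i ≠ l → j ≠ l → j ≠ i₀ → l ≠ i₀ →
      2 * #W ≤ #(B i) + #(B j) + #(B l) → False := by
    intro i j l hij hil hjl hj hl h2
    have hi1 := hBA i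
    have hj1 := hBA j
    have hl1 := hBA l
    have hi2 := hx i
    have hj2 := hx j
    have hl2 := hx l
    have hi3 := hq i
    have hj3 := hq j
    have hl3 := hq l
    have h0 := hx i₀
    by_cases hi : i = i₀
    · subst hi
      have hsub : ({j, l} : Finset (Fin r)) ⊆ univ.erase i := by
        intro a ha; simp only [mem_insert, mem_singleton] at ha
        rcases ha with rfl | rfl <;> simp [*]
      have e1 := sum_le_sum_of_subset (f := x) hsub
      have e2 := sum_le_sum_of_subset (f := fun i => q i % 3) hsub
      rw [sum_pair hjl] at e1 e2
      -- Here `3 ≤ q i₀` is essential: with all three values `q` equal to 2, a triangle is covered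
      -- by three single edges.
      omega
    · have hsub : ({i, j, l} : Finset (Fin r)) ⊆ univ.erase i₀ := by
        intro a ha; simp only [mem_insert, mem_singleton] at ha
        rcases ha with rfl | rfl | rfl <;> simp [*]
      have e1 := sum_le_sum_of_subset (f := x) hsub
      have e2 := sum_le_sum_of_subset (f := fun i => q i % 3) hsub
      rw [sum_insert (by simp [hij, hil]), sum_pair hjl] at e1 e2
      have c1 : ∀ i, #(B i) ≤ 3 * x i + q i % 3 ∧ x i ≤ q i / 3 := fun i => by
        have := hBA i; have := hx i; omega
      have c2 : ∀ i, 3 * (q i / 3) + q i % 3 ≤ q i₀ := fun i => by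
        rw [Nat.div_add_mod]; exact hq i
      refine three_residues_lt hq0 (c2 i) (c2 j) (c2 l) (Nat.mod_lt _ three_pos)
        (Nat.mod_lt _ three_pos) (Nat.mod_lt _ three_pos) ((Nat.le_add_left _ _).trans hS0)
        (e2.trans hmod) ?_
      linarith [c1 i, c1 j, c1 l]
  by_cases hj : j = i₀
  · exact final j i l hij.symm hjl hil (by rwa [← hj]) (by rw [← hj]; exact hjl.symm) (by omega)
  by_cases hl : l = i₀
  · exact final l i j hil.symm hjl.symm hij (by rwa [← hl]) hj (by omega)
  exact final i j l hij hil hjl hj hl h2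

end CliqueCover

/-! ### Star packings and barriers -/

section StarPacking

variable {V : Type*} [Fintype V] [DecidableEq V]

/-- The vertices that `g` sends to `c`. -/
def fiber (g : V → V) (c : V) : Finset V := {w | g w = c}

/-- The vertices whose star is a single vertex. -/
def uncovered (g : V → V) : Finset V := {v | ∀ w, g w = v ↔ w = v}

@[simp] theorem mem_fiber {g : V → V} {c w : V} : w ∈ fiber g c ↔ g w = c := by simp [fiber]

theorem mem_uncovered {g : V → V} {v : V} : v ∈ uncovered g ↔ ∀ w, g w = v ↔ w = v := by
  simp [uncovered]

/-- A partition of the vertices of `G` into stars with at most two leaves, given by the map that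
sends each vertex to the centre of its star. -/
structure IsStarPacking (G : SimpleGraph V) (g : V → V) : Prop where
  idem : ∀ v, g (g v) = g v
  adj : ∀ v, g v ≠ v → G.Adj v (g v)
  card_le : ∀ v, #(fiber g v) ≤ 3

/-- A star packing with the fewest uncovered vertices. -/
structure IsOptimalPacking (G : SimpleGraph V) (g : V → V) : Prop extends IsStarPacking G g where
  le : ∀ h, IsStarPacking G h → #(uncovered g) ≤ #(uncovered h)

theorem exists_isOptimalPacking (G : SimpleGraph V) : ∃ g, IsOptimalPacking G g := by
  have hid : IsStarPacking G id := by
    refine ⟨fun _ => rfl, fun v hv => absurd rfl hv, fun v => ?_⟩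
    have : fiber id v = {v} := by ext; simp
    simp [this]
  obtain ⟨g, hg, hmin⟩ := Set.exists_min_image {g | IsStarPacking G g}
    (fun g => #(uncovered g)) (Set.toFinite _) ⟨id, hid⟩
  exact ⟨g, hg, hmin⟩

variable {G : SimpleGraph V} {g : V → V}

theorem notMem_uncovered_of_card {c : V}
    (hc : #(fiber g c) = 3) : c ∉ uncovered g := by
  intro h
  have : fiber g c = {c} := by ext w; simpa using mem_uncovered.1 h w
  simp [this] at hc

/-- A small star around a neighbour of an uncovered vertex can absorb this vertex. -/
theorem IsStarPacking.absorb (hg : IsStarPacking G g) {u x : V} (hu : u ∈ uncovered g)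
    (hux : G.Adj u x) (hx : #(fiber g (g x)) ≤ 2) :
    IsStarPacking G (fun w => if g w = g x ∨ w = u then x else g w) ∧
      uncovered (fun w => if g w = g x ∨ w = u then x else g w) ⊂ uncovered g := by
  have hu' := mem_uncovered.1 hu
  have hne : u ≠ x := hux.ne
  have hid := hg.idem
  have hpair : ∀ w, g w = g x → w ≠ x → w ≠ g x → g x = x := by
    intro w hw hwx hwg
    by_contra h
    have : ({w, x, g x} : Finset V) ⊆ fiber g (g x) := by
      intro a ha
      simp only [mem_insert, mem_singleton] at ha
      rcases ha with rfl | rfl | rfl <;> simp [hw, hid]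
    have := card_le_card this
    rw [card_insert_of_notMem (by simp [hwx, hwg]), card_pair (Ne.symm h)] at this
    omega
  refine ⟨⟨fun v => by grind, fun v hv => ?_, fun v => ?_⟩, ?_⟩
  · by_cases h : v = u
    · subst h; simpa using hux
    by_cases h' : g v = g x
    · simp only [h', true_or, if_true] at hv ⊢
      by_cases h2 : v = g x
      · have h3 : g x ≠ x := by rw [← h2]; exact hv.symm
        have := hg.adj x h3
        rw [h2]; exact this.symm
      · have h3 := hpair v h' hv.symm h2
        have := hg.adj v (by rw [h', h3]; exact hv)
        rwa [h', h3] at this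
    · simp only [h, h', or_self, if_false] at hv ⊢
      exact hg.adj v hv
  · by_cases h : v = x
    · have : fiber (fun w => if g w = g x ∨ w = u then x else g w) v
          ⊆ insert u (fiber g (g x)) := by
        intro w; simp only [mem_fiber, mem_insert]; grind
      have := (card_le_card this).trans (card_insert_le _ _)
      omega
    · refine (card_le_card fun w => ?_).trans (hg.card_le v)
      simp only [mem_fiber]; grind
  · rw [ssubset_iff_of_subset]
    · refine ⟨u, hu, ?_⟩
      rw [mem_uncovered]; push Not
      exact ⟨u, by grind⟩
    · intro v
      simp only [mem_uncovered]
      intro h w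
      have := h w; have := h u; have := h x; have := h v
      grind

/-- An uncovered vertex can form a new star with a leaf of a star with two leaves. -/
theorem IsStarPacking.detach (hg : IsStarPacking G g) {u x : V} (hu : u ∈ uncovered g)
    (hux : G.Adj u x) (hx : #(fiber g (g x)) = 3) (hxx : g x ≠ x) :
    IsStarPacking G (fun w => if w = x ∨ w = u then x else g w) ∧
      uncovered (fun w => if w = x ∨ w = u then x else g w) ⊂ uncovered g := by
  have hu' := mem_uncovered.1 hu
  have hne : u ≠ x := hux.ne
  have hid := hg.idem
  have hnx : ∀ w, g w ≠ x := fun w hw => hxx (by rw [← hw, hid])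
  obtain ⟨y, hy, hyx, hyg⟩ : ∃ y, g y = g x ∧ y ≠ x ∧ y ≠ g x := by
    by_contra! h
    have : fiber g (g x) ⊆ {x, g x} := by
      intro w; simp only [mem_fiber, mem_insert, mem_singleton]; grind
    have := (card_le_card this).trans card_le_two
    omega
  refine ⟨⟨fun v => by grind, fun v hv => ?_, fun v => ?_⟩, ?_⟩
  · by_cases h : v = u
    · subst h; simpa using hux
    by_cases h' : v = x
    · simp [h'] at hv
    · simp only [h, h', or_self, if_false] at hv ⊢
      exact hg.adj v hv
  · by_cases h : v = x
    · have : fiber (fun w => if w = x ∨ w = u then x else g w) v ⊆ {x, u} := by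
        intro w; simp only [mem_fiber, mem_insert, mem_singleton]; grind
      have := (card_le_card this).trans card_le_two
      omega
    · refine (card_le_card fun w => ?_).trans (hg.card_le v)
      simp only [mem_fiber]; grind
  · rw [ssubset_iff_of_subset]
    · refine ⟨u, hu, ?_⟩
      rw [mem_uncovered]; push Not
      exact ⟨u, by grind⟩
    · intro v
      simp only [mem_uncovered]
      intro h w
      have := h w; have := h u; have := h x; have := h v; have := h y
      grind

/-- Otherwise `absorb` or `detach` would lower the number of uncovered vertices. So `x` is the
centre of a star with two leaves. -/
theorem IsOptimalPacking.card_fiber_of_adj (hg : IsOptimalPacking G g) {u x : V}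
    (hu : u ∈ uncovered g) (hux : G.Adj u x) : #(fiber g x) = 3 := by
  by_cases h2 : #(fiber g (g x)) ≤ 2
  · have := hg.absorb hu hux h2
    exact absurd (hg.le _ this.1) (not_le.2 (card_lt_card this.2))
  have h3 : #(fiber g (g x)) = 3 := by have := hg.card_le (g x); omega
  by_cases hxx : g x = x
  · rwa [hxx] at h3
  · have := hg.detach hu hux h3 hxx
    exact absurd (hg.le _ this.1) (not_le.2 (card_lt_card this.2))

/-- The map obtained by making the uncovered vertex `u` a leaf of the star of the leaf `y`, and `y`
uncovered. -/
def exchange (g : V → V) (u y : V) : V → V :=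
  fun w => if w = u then g y else if w = y then y else g w

/-- The packing `h` arises from `g` by one exchange at a star with two leaves. -/
def Exchange (G : SimpleGraph V) (g h : V → V) : Prop :=
  ∃ u y, u ∈ uncovered g ∧ G.Adj u (g y) ∧ #(fiber g (g y)) = 3 ∧ g y ≠ y ∧ h = exchange g u y

section exchange

variable {u y : V}

theorem IsStarPacking.uncovered_exchange (hg : IsStarPacking G g) (hu : u ∈ uncovered g)
    (hy3 : #(fiber g (g y)) = 3) (hy : g y ≠ y) :
    uncovered (exchange g u y) = insert y ((uncovered g).erase u) := by
  have hu' := mem_uncovered.1 hu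
  have hid := hg.idem
  obtain ⟨z, hz, hzy, hzg⟩ : ∃ z, g z = g y ∧ z ≠ y ∧ z ≠ g y := by
    by_contra! h
    have : fiber g (g y) ⊆ {y, g y} := by
      intro w; simp only [mem_fiber, mem_insert, mem_singleton]; grind
    have := (card_le_card this).trans card_le_two
    omega
  ext v
  simp only [mem_insert, mem_erase, mem_uncovered, exchange]
  constructor
  · intro h
    by_cases hvy : v = y
    · exact Or.inl hvy
    refine Or.inr ⟨?_, fun w => ?_⟩
    · rintro rfl
      have := h v
      grind
    · have := h w; have := h u; have := h y; have := h v; have := h z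
      grind
  · rintro (rfl | ⟨hvu, h⟩) w
    · grind
    · have := h w; have := h u; have := h y; have := h v; have := h z; have := h (g y)
      grind

theorem card_fiber_exchange (hu : u ∈ uncovered g)
    (hy : g y ≠ y) {v : V} (hvu : v ≠ u) (hvy : v ≠ y) :
    #(fiber (exchange g u y) v) = #(fiber g v) := by
  have hu' := mem_uncovered.1 hu
  by_cases hv : v = g y
  · have : fiber (exchange g u y) v = insert u ((fiber g v).erase y) := by
      ext w; simp only [mem_fiber, mem_insert, mem_erase, exchange]; grind
    rw [this, card_insert_of_notMem (by simp; grind), card_erase_add_one (by simp [hv])]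
  · congr 1
    ext w; simp only [mem_fiber, exchange]; grind

/-- An exchange only swaps a leaf, so the set of centres of full stars is an invariant of all
exchanges. -/
theorem IsStarPacking.card_fiber_exchange_eq_three_iff (hg : IsStarPacking G g)
    (hu : u ∈ uncovered g) (hy : g y ≠ y) (v : V) :
    #(fiber (exchange g u y) v) = 3 ↔ #(fiber g v) = 3 := by
  have hu' := mem_uncovered.1 hu
  have hid := hg.idem
  by_cases hvu : v = u
  · have h1 : fiber (exchange g u y) v = ∅ := by
      ext w; simp only [mem_fiber, exchange, notMem_empty, iff_false]; grind
    have h2 : fiber g v = {u} := by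
      ext w; simp only [mem_fiber, mem_singleton]; grind
    simp [h1, h2]
  by_cases hvy : v = y
  · have h1 : fiber (exchange g u y) v = {y} := by
      ext w; simp only [mem_fiber, exchange, mem_singleton]; grind
    have h2 : fiber g v = ∅ := by
      ext w; simp only [mem_fiber, notMem_empty, iff_false]; grind
    simp [h1, h2]
  rw [card_fiber_exchange hu hy hvu hvy]

theorem IsOptimalPacking.exchange (hg : IsOptimalPacking G g) (hu : u ∈ uncovered g)
    (huy : G.Adj u (g y)) (hy3 : #(fiber g (g y)) = 3) (hy : g y ≠ y) :
    IsOptimalPacking G (exchange g u y) := by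
  have hu' := mem_uncovered.1 hu
  have hid := hg.idem
  refine ⟨⟨fun v => ?_, fun v hv => ?_, fun v => ?_⟩, fun h hh => ?_⟩
  · simp only [PathMatchingRamsey.exchange]; grind
  · by_cases h : v = u
    · subst h; simpa [PathMatchingRamsey.exchange] using huy
    by_cases h' : v = y
    · simp [PathMatchingRamsey.exchange, h'] at hv; grind
    · simp only [PathMatchingRamsey.exchange, h, h', if_false] at hv ⊢
      exact hg.adj v hv
  · by_cases h3 : #(fiber (PathMatchingRamsey.exchange g u y) v) = 3
    · omega
    by_cases hvu : v = u
    · have h1 : fiber (PathMatchingRamsey.exchange g u y) v = ∅ := by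
        ext w; simp only [mem_fiber, PathMatchingRamsey.exchange, notMem_empty, iff_false]; grind
      simp [h1]
    by_cases hvy : v = y
    · have h1 : fiber (PathMatchingRamsey.exchange g u y) v ⊆ {y} := by
        intro w; simp only [mem_fiber, PathMatchingRamsey.exchange, mem_singleton]; grind
      exact (card_le_card h1).trans (by simp)
    rw [card_fiber_exchange hu hy hvu hvy]
    exact hg.card_le v
  · rw [hg.uncovered_exchange hu hy3 hy]
    have := card_insert_le y ((uncovered g).erase u)
    rw [card_erase_add_one hu] at this
    exact this.trans (hg.le h hh)

end exchange

/-- The part of the deficiency version of the `{K₁,₁, K₁,₂}`-factor theorem that produces a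
barrier: `S` and the set `A` of the vertices that are neither in `S` nor isolated from `Sᶜ`. -/
theorem exists_barrier (G : SimpleGraph V) : ∃ g, IsStarPacking G g ∧ ∃ S A : Finset V,
    #A + 3 * #S + #(uncovered g) ≤ Fintype.card V ∧
    ∀ u v, G.Adj u v → u ∈ S ∨ v ∈ S ∨ (u ∈ A ∧ v ∈ A) := by
  classical
  obtain ⟨g, hg⟩ := exists_isOptimalPacking G
  let R := Relation.ReflTransGen (Exchange G) g
  -- The vertices that some sequence of exchanges leaves uncovered; the barrier `S` will be their
  -- neighbourhood.
  let I : Finset V := {v | ∃ h, R h ∧ v ∈ uncovered h}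
  have hI : ∀ {h v}, R h → v ∈ uncovered h → v ∈ I := fun hh hv => by
    simp only [I, mem_filter, mem_univ, true_and]; exact ⟨_, hh, hv⟩
  have inv : ∀ h, R h → IsOptimalPacking G h ∧ (∀ v, #(fiber h v) = 3 ↔ #(fiber g v) = 3) ∧
      ∀ v, v ∉ I → h v = g v := by
    intro h hh
    induction hh with
    | refl => exact ⟨hg, fun _ => Iff.rfl, fun _ _ => rfl⟩
    | @tail h h' hh hs ih =>
      obtain ⟨ho, hc, he⟩ := ih
      have hh' : R h' := Relation.ReflTransGen.tail hh hs
      obtain ⟨u, y, hu, huy, hy3, hy, rfl⟩ := hs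
      refine ⟨ho.exchange hu huy hy3 hy, fun v => ?_, fun v hv => ?_⟩
      · rw [ho.card_fiber_exchange_eq_three_iff hu hy, hc]
      · have h1 : v ≠ u := by rintro rfl; exact hv (hI hh hu)
        have h2 : v ≠ y := by
          rintro rfl
          exact hv (hI hh' (by rw [ho.uncovered_exchange hu hy3 hy]; exact mem_insert_self _ _))
        rw [← he v hv]
        simp [exchange, h1, h2]
  let S : Finset V := {c | ∃ u ∈ I, G.Adj u c}
  have hS3 : ∀ c ∈ S, #(fiber g c) = 3 := by
    intro c hc
    simp only [S, I, mem_filter, mem_univ, true_and] at hc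
    obtain ⟨u, ⟨h, hh, hu⟩, huc⟩ := hc
    obtain ⟨ho, hc3, -⟩ := inv h hh
    exact (hc3 c).1 (ho.card_fiber_of_adj hu huc)
  -- A leaf `y` outside `I` keeps its centre `c` in every reachable packing. In one where a
  -- neighbour of `c` is uncovered, one more exchange would uncover `y`.
  have hleaf : ∀ c ∈ S, ∀ y, g y = c → y ∈ I ∪ S := by
    intro c hc y hyc
    by_contra hy
    have hyI : y ∉ I := fun h => hy (mem_union_left _ h)
    have hyc' : y ≠ c := by rintro rfl; exact hy (mem_union_right _ hc)
    simp only [S, I, mem_filter, mem_univ, true_and] at hc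
    obtain ⟨u, ⟨h, hh, hu⟩, huc⟩ := hc
    obtain ⟨ho, hc3, he⟩ := inv h hh
    have hhy : h y = c := by rw [he y hyI, hyc]
    have h3 : #(fiber h (h y)) = 3 := by rw [hhy]; exact ho.card_fiber_of_adj hu huc
    have hne : h y ≠ y := by rw [hhy]; exact hyc'.symm
    refine hyI (hI (Relation.ReflTransGen.tail hh ⟨u, y, hu, by rwa [hhy], h3, hne, rfl⟩) ?_)
    rw [ho.uncovered_exchange hu h3 hne]
    exact mem_insert_self _ _
  refine ⟨g, hg.toIsStarPacking, S, (I ∪ S)ᶜ, ?_, fun u v huv => ?_⟩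
  · have hU : uncovered g ∪ S.biUnion (fiber g) ⊆ I ∪ S := by
      refine union_subset (fun v hv => mem_union_left _ (hI Relation.ReflTransGen.refl hv)) ?_
      rw [biUnion_subset]
      intro c hc y hy
      exact hleaf c hc y (mem_fiber.1 hy)
    have hdisj : Disjoint (uncovered g) (S.biUnion (fiber g)) := by
      rw [disjoint_left]
      intro v hv hv'
      obtain ⟨c, hc, hvc⟩ := mem_biUnion.1 hv'
      rw [mem_fiber, (mem_uncovered.1 hv v).2 rfl] at hvc
      subst hvc
      exact notMem_uncovered_of_card (hS3 v hc) hv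
    have hbi : #(S.biUnion (fiber g)) = 3 * #S := by
      rw [card_biUnion, sum_congr rfl hS3, sum_const, smul_eq_mul, mul_comm]
      intro a _ b _ hab
      rw [Function.onFun, disjoint_left]
      intro v hv hv'
      rw [mem_fiber] at hv hv'
      exact hab (hv.symm.trans hv')
    have h1 := card_le_card hU
    rw [card_union_of_disjoint hdisj, hbi] at h1
    have h2 := card_add_card_compl (I ∪ S)
    omega
  · have h1 : u ∈ I → v ∈ S := fun hu => by
      simp only [S, mem_filter, mem_univ, true_and]; exact ⟨u, hu, huv⟩
    have h2 : v ∈ I → u ∈ S := fun hv => by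
      simp only [S, mem_filter, mem_univ, true_and]; exact ⟨v, hv, huv.symm⟩
    simp only [mem_compl, mem_union]
    tauto

/-- A star of a packing with at least one leaf is spanned by a path. -/
theorem IsStarPacking.exists_path (hg : IsStarPacking G g) {c : V} (hc : g c = c)
    (hcu : c ∉ uncovered g) : ∃ P : Σ u v : V, G.Path u v,
      2 ≤ (P.2.2 : G.Walk P.1 P.2.1).support.length ∧
      ∀ v, v ∈ (P.2.2 : G.Walk P.1 P.2.1).support ↔ g v = c := by
  obtain ⟨y, hy, hyc⟩ : ∃ y, g y = c ∧ y ≠ c := by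
    by_contra! h
    exact hcu (mem_uncovered.2 fun w => ⟨h w, fun hw => hw ▸ hc⟩)
  have hadj : ∀ w, g w = c → w ≠ c → G.Adj w c := fun w hw hwc => by
    have := hg.adj w (by rw [hw]; exact hwc.symm)
    rwa [hw] at this
  by_cases hz : ∃ z, g z = c ∧ z ≠ c ∧ z ≠ y
  · obtain ⟨z, hz, hzc, hzy⟩ := hz
    have hf : ({y, c, z} : Finset V) = fiber g c := by
      refine eq_of_subset_of_card_le ?_ ?_
      · intro a ha
        simp only [mem_insert, mem_singleton] at ha
        rcases ha with rfl | rfl | rfl <;> simp [*]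
      · rw [card_insert_of_notMem (by simp [hyc, hzy.symm]), card_pair hzc.symm]
        exact hg.card_le c
    refine ⟨⟨y, z, .cons (hadj y hy hyc) (.cons (hadj z hz hzc).symm .nil), ?_⟩, ?_, fun v => ?_⟩
    · simp [hyc, hzy.symm, hzc.symm]
    · simp
    · rw [← mem_fiber, ← hf]; simp
  · push Not at hz
    refine ⟨⟨y, c, .cons (hadj y hy hyc) .nil, by simp [hyc]⟩, by simp, fun v => ?_⟩
    simp only [SimpleGraph.Walk.support_cons, SimpleGraph.Walk.support_nil, List.mem_cons,
      List.not_mem_nil, or_false]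
    constructor
    · rintro (rfl | rfl) <;> assumption
    · intro hv
      by_cases hvc : v = c
      · exact Or.inr hvc
      · exact Or.inl (hz v hv hvc)

theorem IsStarPacking.exists_pathMatching (hg : IsStarPacking G g) :
    ∃ M : PathMatching G, M.order + #(uncovered g) = Fintype.card V := by
  classical
  have hex := fun c : {c // g c = c ∧ c ∉ uncovered g} => hg.exists_path c.2.1 c.2.2
  choose P hP2 hP using hex
  refine ⟨⟨univ.image P, ?_, ?_⟩, ?_⟩
  · simp only [mem_image, mem_univ, true_and]
    rintro _ ⟨c, rfl⟩
    exact hP2 c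
  · simp only [mem_image, mem_univ, true_and]
    rintro _ ⟨c, rfl⟩ _ ⟨d, rfl⟩ hcd v hv hv'
    rw [hP] at hv hv'
    exact hcd (by rw [Subtype.ext (hv.symm.trans hv')])
  · have : PathMatching.verts (⟨univ.image P, by
        simp only [mem_image, mem_univ, true_and]
        rintro _ ⟨c, rfl⟩
        exact hP2 c, by
        simp only [mem_image, mem_univ, true_and]
        rintro _ ⟨c, rfl⟩ _ ⟨d, rfl⟩ hcd v hv hv'
        rw [hP] at hv hv'
        exact hcd (by rw [Subtype.ext (hv.symm.trans hv')])⟩ : PathMatching G)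
        = ((uncovered g)ᶜ : Finset V) := by
      ext v
      simp only [PathMatching.verts, mem_image, mem_univ, true_and, Set.mem_ofPred_eq, coe_compl,
        Set.mem_compl_iff, mem_coe]
      constructor
      · rintro ⟨_, ⟨c, rfl⟩, hv⟩ hvu
        rw [hP, (mem_uncovered.1 hvu v).2 rfl] at hv
        exact c.2.2 (hv ▸ hvu)
      · intro hv
        refine ⟨_, ⟨⟨g v, hg.idem v, fun h => hv ?_⟩, rfl⟩, (hP _ v).2 rfl⟩
        rw [(mem_uncovered.1 h v).1 rfl]
        exact h
    rw [PathMatching.order, this, Set.ncard_coe_finset, add_comm, card_add_card_compl]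

end StarPacking

/-! ### Bounds on the order of a path-matching -/

section UpperBounds

variable {V : Type*} {G : SimpleGraph V}

/-- No two consecutive vertices of a walk avoid `S`. The last summand depends on the first vertex to
make the induction work. -/
theorem length_support_le_of_adj_cover [DecidableEq V] {S : Finset V}
    (hS : ∀ u v, G.Adj u v → u ∈ S ∨ v ∈ S) {u v : V} (w : G.Walk u v) :
    w.support.length ≤ 2 * w.support.countP (· ∈ S) + (if u ∈ S then 0 else 1) := by
  induction w with
  | nil => split_ifs <;> simp [*]
  | cons h w ih =>
    have := hS _ _ h
    simp only [SimpleGraph.Walk.support_cons, List.length_cons, List.countP_cons, decide_eq_true_eq]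
    split_ifs at ih ⊢ <;> grind

theorem length_support_le_three_mul [DecidableEq V] {S : Finset V}
    (hS : ∀ u v, G.Adj u v → u ∈ S ∨ v ∈ S) {u v : V} (w : G.Walk u v)
    (hw : 2 ≤ w.support.length) : w.support.length ≤ 3 * w.support.countP (· ∈ S) := by
  have := length_support_le_of_adj_cover hS w
  split_ifs at this <;> omega

theorem PathMatching.order_le_of_adj_cover {S : Finset V}
    (hS : ∀ u v, G.Adj u v → u ∈ S ∨ v ∈ S) (M : PathMatching G) : M.order ≤ 3 * #S := by
  classical
  let s : (Σ u v : V, G.Path u v) → Finset V := fun P => (P.2.2 : G.Walk P.1 P.2.1).support.toFinset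
  have hs : ∀ P ∈ M.paths, #(s P) ≤ 3 * #(s P ∩ S) := by
    intro P hP
    have h1 := length_support_le_three_mul hS _ (M.two_le_vertices P hP)
    have hnd : (P.2.2 : G.Walk P.1 P.2.1).support.Nodup := P.2.2.2.support_nodup
    have h2 : #(s P) = (P.2.2 : G.Walk P.1 P.2.1).support.length :=
      List.toFinset_card_of_nodup hnd
    have h3 : #(s P ∩ S) = (P.2.2 : G.Walk P.1 P.2.1).support.countP (· ∈ S) := by
      rw [List.countP_eq_length_filter, ← List.toFinset_card_of_nodup (hnd.filter _)]
      congr 1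
      ext; simp [s]
    omega
  have hverts : M.verts = (M.paths.biUnion s : Finset V) := by
    ext v; simp [PathMatching.verts, s]
  have hdisj : ∀ P ∈ M.paths, ∀ Q ∈ M.paths, P ≠ Q → Disjoint (s P ∩ S) (s Q ∩ S) := by
    intro P hP Q hQ hPQ
    rw [disjoint_left]
    intro v hv hv'
    simp only [s, mem_inter, List.mem_toFinset] at hv hv'
    exact M.disjoint P hP Q hQ hPQ v hv.1 hv'.1
  calc M.order = #(M.paths.biUnion s) := by rw [PathMatching.order, hverts, Set.ncard_coe_finset]
    _ ≤ ∑ P ∈ M.paths, #(s P) := card_biUnion_le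
    _ ≤ ∑ P ∈ M.paths, 3 * #(s P ∩ S) := sum_le_sum hs
    _ = 3 * #(M.paths.biUnion fun P => s P ∩ S) := by rw [← mul_sum, card_biUnion hdisj]
    _ ≤ 3 * #S := Nat.mul_le_mul_left _ <| card_le_card <| biUnion_subset.2
        fun _ _ => inter_subset_right

theorem exists_adj_of_mem_support {u v x : V} (w : G.Walk u v) (hw : 2 ≤ w.support.length)
    (hx : x ∈ w.support) : ∃ y, G.Adj x y := by
  induction w with
  | nil => simp at hw
  | @cons a b c h w ih =>
    rw [SimpleGraph.Walk.support_cons, List.mem_cons] at hx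
    rcases hx with rfl | hx
    · exact ⟨_, h⟩
    cases w with
    | nil =>
      simp only [SimpleGraph.Walk.support_nil, List.mem_singleton] at hx
      exact ⟨a, hx ▸ h.symm⟩
    | cons h' w' => exact ih (by simp) hx

theorem PathMatching.order_le_of_adj_mem {A : Finset V} (hA : ∀ u v, G.Adj u v → u ∈ A)
    (M : PathMatching G) : M.order ≤ #A := by
  rw [← Set.ncard_coe_finset, PathMatching.order]
  refine Set.ncard_le_ncard ?_ A.finite_toSet
  rintro v ⟨P, hP, hv⟩
  obtain ⟨y, hy⟩ := exists_adj_of_mem_support _ (M.two_le_vertices P hP) hv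
  exact hA v y hy

end UpperBounds

/-! ### The extremal colouring, and the value of the Ramsey number -/

theorem not_arrows {r : ℕ} (i₀ : Fin r) (hi₀ : ∀ i, i₀ ≤ i) (p : Fin r → ℕ) (hp : ∀ i, 1 ≤ p i)
    {n : ℕ} (hn : n ≤ p i₀ - 1 + ∑ i ∈ univ.erase i₀, (p i - 1) / 3) : ¬ Arrows p n := by
  classical
  let k : Fin r → ℕ := fun i => if i = i₀ then p i₀ - 1 else (p i - 1) / 3
  have hk : ∑ i, k i = p i₀ - 1 + ∑ i ∈ univ.erase i₀, (p i - 1) / 3 := by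
    rw [← add_sum_erase _ _ (mem_univ i₀)]
    congr 1
    · simp [k]
    · exact sum_congr rfl fun i hi => by simp [k, ne_of_mem_erase hi]
  -- The embedding assigns vertices to blocks of capacity `k i`, so it also handles every smaller
  -- `n`.
  obtain ⟨e⟩ : Nonempty (Fin n ↪ Σ i, Fin (k i)) :=
    Function.Embedding.nonempty_of_card_le (by simpa [hk] using hn)
  let φ : Fin n → Fin r := fun v => (e v).1
  have hφ : ∀ i, #{v | φ v = i} ≤ k i := by
    intro i
    calc #{v | φ v = i} = #(({v | φ v = i} : Finset (Fin n)).map e) := (card_map _).symm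
      _ ≤ #((univ : Finset (Fin (k i))).map (Function.Embedding.sigmaMk (β := fun i => Fin (k i)) i)) := by
        refine card_le_card fun x hx => ?_
        simp only [mem_map, mem_filter, mem_univ, true_and] at hx ⊢
        obtain ⟨v, hv, rfl⟩ := hx
        subst hv
        exact ⟨(e v).2, rfl⟩
      _ = k i := by simp
  intro h
  obtain ⟨i, M, hM⟩ := h (SimpleGraph.EdgeLabeling.mk (fun u v _ => max (φ u) (φ v))
    fun u v _ => max_comm _ _)
  have hadj : ∀ u v, (SimpleGraph.EdgeLabeling.labelGraph (SimpleGraph.EdgeLabeling.mk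
      (G := (⊤ : SimpleGraph (Fin n))) (fun u v _ => max (φ u) (φ v))
        fun u v _ => max_comm _ _) i).Adj u v → max (φ u) (φ v) = i := by
    intro u v huv
    rw [SimpleGraph.EdgeLabeling.labelGraph_adj] at huv
    obtain ⟨H, h⟩ := huv
    exact h
  have hki := hφ i
  have hpi := hp i
  by_cases hi : i = i₀
  · have := M.order_le_of_adj_mem (A := {v | φ v = i}) fun u v huv => by
      have h1 := hadj u v huv
      simp only [mem_filter, mem_univ, true_and]
      -- As `i₀` is the least colour, a maximum equal to `i₀` puts both ends in block `i₀`.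
      exact le_antisymm (h1 ▸ le_max_left _ _) (hi ▸ hi₀ _)
    simp only [k, hi, if_true] at hki
    subst hi
    omega
  · have := M.order_le_of_adj_cover (S := {v | φ v = i}) fun u v huv => by
      have h1 := hadj u v huv
      simp only [mem_filter, mem_univ, true_and]
      rcases max_choice (φ u) (φ v) with h | h
      · exact Or.inl (h.symm.trans h1)
      · exact Or.inr (h.symm.trans h1)
    simp only [k, hi, if_false] at hki
    omega

theorem arrows_of_card {r : ℕ} (i₀ : Fin r) (p : Fin r → ℕ) (hle : ∀ i, p i ≤ p i₀)
    (hp : ∀ i, 1 ≤ p i) (hp4 : 4 ≤ p i₀)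
    (hmod : ∑ i ∈ univ.erase i₀, (p i - 1) % 3 ≤ p i₀ - 1 + 2) :
    Arrows p (p i₀ - 1 + 1 + ∑ i ∈ univ.erase i₀, (p i - 1) / 3) := by
  intro c
  by_contra! hlt
  choose g hg S A hSA hadj using fun i => exists_barrier (c.labelGraph i)
  refine not_covered_by_stars_and_cliques i₀ (fun i => p i - 1)
    (fun i => Nat.sub_le_sub_right (hle i) 1) (by omega) hmod (Fintype.card_fin _) S A
    (fun i => ?_) fun u v huv => ?_
  · obtain ⟨M, hM⟩ := (hg i).exists_pathMatching
    have := hlt i M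
    have := hSA i
    have := hp i
    omega
  · exact ⟨c.get u v huv, hadj _ u v (by simp [huv])⟩

theorem ramseyPM_eq {r : ℕ} {p : Fin r → ℕ} {n : ℕ} (hn : Arrows p n)
    (hlt : ∀ m < n, ¬ Arrows p m) : ramseyPM p = n :=
  le_antisymm (Nat.sInf_le hn) (le_csInf ⟨n, hn⟩ fun m hm => not_lt.1 fun h => hlt m h hm)

theorem ceil_div_three {a : ℕ} (ha : 1 ≤ a) :
    ⌈(a : ℚ) / 3⌉ = (((a - 1) / 3 : ℕ) : ℤ) + 1 := by
  have h1 : 3 * ((a - 1) / 3) + 1 ≤ a := by omega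
  have h2 : a ≤ 3 * ((a - 1) / 3) + 3 := by omega
  have h1' : (3 * ((a - 1) / 3 : ℕ) + 1 : ℚ) ≤ a := by exact_mod_cast h1
  have h2' : (a : ℚ) ≤ 3 * ((a - 1) / 3 : ℕ) + 3 := by exact_mod_cast h2
  rw [Int.ceil_eq_iff]
  constructor
  · rw [lt_div_iff₀ (by norm_num)]; rw [Int.cast_add, Int.cast_natCast, Int.cast_one]; linarith
  · rw [div_le_iff₀ (by norm_num)]; rw [Int.cast_add, Int.cast_natCast, Int.cast_one]; linarith

/-- This turns the rounding errors in the hypothesis into residues: the terms `2 * r` cancel and the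
residue sum is at most `p i₀ + 1`. -/
theorem three_mul_ceil_sub {a : ℕ} (ha : 1 ≤ a) :
    3 * ((⌈(a : ℚ) / 3⌉ : ℚ) - (a : ℚ) / 3) = 2 - ((a - 1) % 3 : ℕ) := by
  have h : 3 * ((a - 1) / 3) + (a - 1) % 3 + 1 = a := by omega
  have h' : (3 * ((a - 1) / 3 : ℕ) + ((a - 1) % 3 : ℕ) + 1 : ℚ) = a := by exact_mod_cast h
  rw [ceil_div_three ha, Int.cast_add, Int.cast_natCast, Int.cast_one]
  linarith

end PathMatchingRamsey

theorem theorem1p2 (r : ℕ) (hr : 3 ≤ r) (p : Fin r → ℕ) (hp : Antitone p)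
    (hp2 : ∀ i, 2 ≤ p i) (hp1 : 4 ≤ p ⟨0, by omega⟩)
    (hcond : 2 * (r : ℚ) - 3
        - ∑ i ∈ Finset.univ.erase (⟨0, by omega⟩ : Fin r),
            3 * ((⌈(p i : ℚ) / 3⌉ : ℚ) - (p i : ℚ) / 3)
      ≤ (p ⟨0, by omega⟩ : ℚ)) :
    {n : ℕ | PathMatchingRamsey.Arrows p n}.Nonempty ∧
    (PathMatchingRamsey.ramseyPM p : ℤ) =
      (p ⟨0, by omega⟩ : ℤ) - ((r : ℤ) - 1)
        + ∑ i ∈ Finset.univ.erase (⟨0, by omega⟩ : Fin r), ⌈(p i : ℚ) / 3⌉ := by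
  have hone : ∀ i, 1 ≤ p i := fun i => one_le_two.trans (hp2 i)
  have hr0 : 0 < r := by omega
  set i₀ : Fin r := ⟨0, hr0⟩
  have hi₀ : ∀ i, i₀ ≤ i := fun i => Nat.zero_le _
  have hcard : #(univ.erase i₀) = r - 1 := by simp
  have hmod : ∑ i ∈ univ.erase i₀, (p i - 1) % 3 ≤ p i₀ - 1 + 2 := by
    rw [sum_congr rfl fun i _ => PathMatchingRamsey.three_mul_ceil_sub (hone i), sum_sub_distrib,
      sum_const, hcard, nsmul_eq_mul, Nat.cast_sub (by omega), ← Nat.cast_sum] at hcond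
    have h : ((∑ i ∈ univ.erase i₀, (p i - 1) % 3 : ℕ) : ℚ) ≤ p i₀ + 1 := by
      push_cast at hcond ⊢; linarith
    have h' : (∑ i ∈ univ.erase i₀, (p i - 1) % 3) ≤ p i₀ + 1 := by exact_mod_cast h
    omega
  have harrows := PathMatchingRamsey.arrows_of_card i₀ p (fun i => hp (hi₀ i)) hone hp1 hmod
  refine ⟨⟨_, harrows⟩, ?_⟩
  rw [PathMatchingRamsey.ramseyPM_eq harrows fun m hm =>
      PathMatchingRamsey.not_arrows i₀ hi₀ p hone (by omega),
    sum_congr rfl fun i _ => PathMatchingRamsey.ceil_div_three (hone i), sum_add_distrib,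
    sum_const, hcard, Nat.sub_add_cancel (hone i₀)]
  push_cast [Nat.cast_sub (show 1 ≤ r by omega)]
  simp only [nsmul_eq_mul]
  push_cast [Nat.cast_sub (show 1 ≤ r by omega)]
  ring
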